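/- Let $X$ be a set, let $Z\subseteq X$ be an at most countable subset, and let $F(X)$ and $F(Z)$ be the free groups over $X$ and $Z$; the group $F(Z)$ is identified, via the homomorphism $F(Z)\to F(X)$ extending the inclusion $Z\hookrightarrow X$, with the subgroup of $F(X)$ generated by $Z$. Then for every Hausdorff group topology $\mathscr{T}$ on $F(Z)$ there exists a Hausdorff group topology $\mathscr{T}'$ on $F(X)$ which extends $\mathscr{T}$, that is, such that $\mathscr{T}=\{U\cap F(Z): U\in\mathscr{T}'\}$. In other words, $F(Z)$ is Hausdorff embedded in $F(X)$, where a subgroup $H$ of a group $G$ is called *Hausdorff embedded* in $G$ if for every Hausdorff group topology $\mathscr{T}$ on $H$ there exists a Hausdorff group topology $\mathscr{T}'$ on $G$ whose subspace topology on $H$ is $\mathscr{T}$. -/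

import Mathlib

/-- `T` is a Hausdorff group topology on the group `G`: multiplication and inversion are
continuous for `T`, and `T` is Hausdorff. -/
structure IsHausdorffGroupTopology {G : Type*} [Group G] (T : TopologicalSpace G) : Prop where
  isTopologicalGroup : @IsTopologicalGroup G T _
  t2Space : @T2Space G T

/-- A subgroup `H` of `G` is Hausdorff embedded in `G` if every Hausdorff group topology on `H`
is the subspace topology of some Hausdorff group topology on `G`. -/
def Subgroup.IsHausdorffEmbedded {G : Type*} [Group G] (H : Subgroup G) : Prop :=
  ∀ T : TopologicalSpace H, IsHausdorffGroupTopology T →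
    ∃ T' : TopologicalSpace G, IsHausdorffGroupTopology T' ∧
      T = TopologicalSpace.induced (Subtype.val : H → G) T'

open Filter Topology Uniformity BoundedContinuousFunction
open scoped ENNReal

universe u

/-! Write G for F(Z) with its topology; killing the letters outside Z retracts F(X) onto G. The
extension is the join of all group topologies on F(X) for which G → F(X) is continuous. The topology
pulled back along the retraction is one of them, so the join induces the given topology on G and
separates from 1 whatever the retraction does not kill. It remains to find, for each p ≠ 1 in the
kernel, one such topology separating p from 1 (`IsHausdorffGroupTopology.exists_extension`).

F(X) embeds in F(G × X) ⋊ G, the letter (s, x) standing for s x s⁻¹. Let A be a normed algebra whose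
units 1 + a(s, x), with a(s, x)² = 0, generate a free group freely, and let R be the ring of bounded
continuous functions G → A with continuous orbits under right translation. Then Rˣ ⋊ G is a
topological group. Bump functions give h_x in R with h_x² = 0 and h_x(s) = a(s, x) for the finitely
many s occurring in p. Sending (s, x) to the translate of 1 + h_x by s and evaluating at 1 recovers
1 + a(s, x) on the letters of p, so p is detected (`exists_groupTopology_semidirect_separating`). -/

/-! ### Uniformly continuous bump functions -/

theorem exists_seq_nhds_one_symm_mul {G : Type*} [Group G] [TopologicalSpace G]
    [IsTopologicalGroup G] {U : Set G} (hU : U ∈ 𝓝 (1 : G)) :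
    ∃ W : ℕ → Set G, W 0 ⊆ U ∧ (∀ n, W n ∈ 𝓝 (1 : G)) ∧ (∀ n, ∀ x ∈ W n, x⁻¹ ∈ W n) ∧
      ∀ n, ∀ x ∈ W (n + 1), ∀ y ∈ W (n + 1), x * y ∈ W n := by
  have step : ∀ V : {V : Set G // V ∈ 𝓝 (1 : G)}, ∃ V' : {V : Set G // V ∈ 𝓝 (1 : G)},
      (∀ x ∈ V'.1, x⁻¹ ∈ V'.1) ∧ ∀ x ∈ V'.1, ∀ y ∈ V'.1, x * y ∈ V.1 := by
    rintro ⟨V, hV⟩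
    obtain ⟨A, hA, hAV⟩ := exists_nhds_one_split hV
    refine ⟨⟨A ∩ A⁻¹, inter_mem hA (inv_mem_nhds_one G hA)⟩, ?_, ?_⟩
    · rintro x ⟨h1, h2⟩
      exact ⟨by simpa using h2, by simpa using h1⟩
    · rintro x ⟨h1, -⟩ y ⟨h2, -⟩
      exact hAV x h1 y h2
  choose F hF1 hF2 using step
  let W : ℕ → {V : Set G // V ∈ 𝓝 (1 : G)} := fun n => Nat.rec (F ⟨U, hU⟩) (fun _ V => F V) n
  refine ⟨fun n => (W n).1, ?_, fun n => (W n).2, ?_, fun n => hF2 (W n)⟩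
  · intro x hx
    simpa using hF2 ⟨U, hU⟩ x hx 1 (mem_of_mem_nhds (W 0).2)
  · rintro (_ | n)
    · exact hF1 _
    · exact hF1 _

/-- Every neighbourhood of the identity of a topological group supports a bump function which is
uniformly continuous for right translations. -/
theorem exists_bump_right_uniform {G : Type*} [Group G] [TopologicalSpace G]
    [IsTopologicalGroup G] {U : Set G} (hU : U ∈ 𝓝 (1 : G)) :
    ∃ ψ : G → ℝ, ψ 1 = 1 ∧ (∀ x, 0 ≤ ψ x) ∧ (∀ x, ψ x ≤ 1) ∧ (∀ x ∉ U, ψ x = 0) ∧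
      ∀ ε > 0, ∀ᶠ g in 𝓝 (1 : G), ∀ x, |ψ (x * g) - ψ x| < ε := by
  obtain ⟨W, hWU, hW, hinv, hmul⟩ := exists_seq_nhds_one_symm_mul hU
  have h1 : ∀ n, (1 : G) ∈ W n := fun n => mem_of_mem_nhds (hW n)
  have hanti : Antitone W := antitone_nat_of_succ_le fun n x hx => by
    simpa using hmul n x hx 1 (h1 _)
  -- These entourages are left invariant, so (x, x * g) lies in `S n` for all x at once when g is in
  -- `W n`. Being countably many, they come from a pseudometric.
  let S : ℕ → Set (G × G) := fun n => {q | q.1⁻¹ * q.2 ∈ W n}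
  have hS : Antitone S := fun m n hmn q hq => hanti hmn hq
  let c : UniformSpace.Core G := UniformSpace.Core.mkOfBasis
    { sets := Set.range S
      nonempty := Set.range_nonempty S
      inter_sets := by
        rintro _ _ ⟨m, rfl⟩ ⟨n, rfl⟩
        exact ⟨_, ⟨max m n, rfl⟩, Set.subset_inter (hS (le_max_left _ _)) (hS (le_max_right _ _))⟩ }
    (by rintro _ ⟨n, rfl⟩ x; simpa [S] using h1 n)
    (by
      rintro _ ⟨n, rfl⟩
      refine ⟨_, ⟨n, rfl⟩, fun q hq => ?_⟩
      simpa [S] using hinv n _ hq)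
    (by
      rintro _ ⟨n, rfl⟩
      refine ⟨_, ⟨n + 1, rfl⟩, ?_⟩
      rintro ⟨x, z⟩ ⟨y, hxy, hyz⟩
      simpa [S, mul_assoc] using hmul n _ hxy _ hyz)
  let _ : UniformSpace G := UniformSpace.ofCore c
  have hbasis : (𝓤 G).HasBasis (fun _ : ℕ => True) S :=
    ⟨fun t => (FilterBasis.mem_filter_iff _).trans
      ⟨by rintro ⟨_, ⟨n, rfl⟩, h⟩; exact ⟨n, trivial, h⟩,
        by rintro ⟨n, -, h⟩; exact ⟨_, ⟨n, rfl⟩, h⟩⟩⟩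
  have : (𝓤 G).IsCountablyGenerated := hbasis.isCountablyGenerated
  let _ := UniformSpace.pseudoMetricSpace G
  obtain ⟨r, hr, hrS⟩ := Metric.mem_uniformity_dist.1 (hbasis.mem_of_mem (i := 0) trivial)
  refine ⟨fun x => max 0 (1 - dist 1 x / r), by simp, fun x => le_max_left _ _, fun x => ?_,
    fun x hx => ?_, fun ε hε => ?_⟩
  · exact max_le zero_le_one (sub_le_self _ (by positivity))
  · refine max_eq_left (sub_nonpos.2 ((one_le_div hr).2 (not_lt.1 fun h => hx (hWU ?_))))
    simpa [S] using hrS h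
  · obtain ⟨n, -, hn⟩ := hbasis.mem_iff.1 (Metric.dist_mem_uniformity (mul_pos hε hr))
    filter_upwards [hW n] with g hg x
    have hd : dist x (x * g) < ε * r := hn (show (x, x * g) ∈ S n by simpa [S] using hg)
    calc |max 0 (1 - dist 1 (x * g) / r) - max 0 (1 - dist 1 x / r)|
        ≤ |(1 - dist 1 (x * g) / r) - (1 - dist 1 x / r)| := by
          simpa using abs_max_sub_max_le_max 0 (1 - dist 1 (x * g) / r) 0 (1 - dist 1 x / r)
      _ = |dist x 1 - dist (x * g) 1| / r := by
          rw [← abs_of_pos hr, ← abs_div, abs_of_pos hr, dist_comm x, dist_comm (x * g)]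
          congr 1
          ring
      _ ≤ dist x (x * g) / r := by
          gcongr
          exact abs_dist_sub_le _ _ _
      _ < ε := (div_lt_iff₀ hr).2 hd

/-! ### A free group of operators 1 + x with x² = 0 -/

/-- The unit `1 + x` of a ring, for an element `x` of square zero. -/
def Units.oneAddOfSqZero {A : Type*} [Ring A] (x : A) (hx : x * x = 0) : Aˣ where
  val := 1 + x
  inv := 1 - x
  val_inv := by noncomm_ring; simp [hx]
  inv_val := by noncomm_ring; simp [hx]

@[simp]
theorem Units.val_oneAddOfSqZero {A : Type*} [Ring A] (x : A) (hx : x * x = 0) :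
    (Units.oneAddOfSqZero x hx : A) = 1 + x := rfl

theorem Units.val_oneAddOfSqZero_zpow {A : Type*} [Ring A] (x : A) (hx : x * x = 0) (n : ℤ) :
    ((Units.oneAddOfSqZero x hx ^ n : Aˣ) : A) = 1 + n • x := by
  have hinv : ((Units.oneAddOfSqZero x hx)⁻¹ : Aˣ).val = 1 - x := rfl
  induction n using Int.induction_on with
  | zero => simp
  | succ n ih =>
    rw [zpow_add_one, Units.val_mul, ih, Units.val_oneAddOfSqZero, mul_add, add_mul _ _ x,
      smul_mul_assoc, hx, add_smul]
    simp [add_assoc]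
  | pred n ih =>
    rw [zpow_sub_one, Units.val_mul, ih, hinv, mul_sub, add_mul _ _ x, smul_mul_assoc,
      hx, sub_smul]
    simp [add_sub_assoc]

namespace FreeGroup

variable {I : Type*}

/-- Bounded real functions on the words over an alphabet. -/
abbrev WordSpace (I : Type*) := lp (fun _ : List I => ℝ) ∞

open Classical in
/-- Whether a word starts with the letter `i`, followed by another letter or by nothing. -/
noncomputable def prefixWeight (i : I) (w : List I) : ℝ :=
  if w.head? = some i ∧ w.tail.head? ≠ some i then 1 else 0

theorem abs_prefixWeight_le (i : I) (w : List I) : |prefixWeight i w| ≤ 1 := by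
  unfold prefixWeight; split_ifs <;> simp

theorem prefixWeight_mul_tail (i : I) (w : List I) :
    prefixWeight i w * prefixWeight i w.tail = 0 := by
  unfold prefixWeight; split_ifs <;> simp_all

/-- The operator that prepends the letter `i` to the words not starting with `i`. -/
noncomputable def prepend (i : I) : WordSpace I →L[ℝ] WordSpace I :=
  LinearMap.mkContinuous
    { toFun := fun p => ⟨fun w => prefixWeight i w * p w.tail, memℓp_infty ⟨‖p‖, by
        rintro _ ⟨w, rfl⟩
        simp only [norm_mul, Real.norm_eq_abs]
        exact (mul_le_of_le_one_left (abs_nonneg _) (abs_prefixWeight_le i w)).trans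
          (lp.norm_apply_le_norm ENNReal.top_ne_zero p _)⟩⟩
      map_add' := fun p q => by ext w; simp [mul_add]; rfl
      map_smul' := fun c p => by ext w; simp [mul_left_comm] } 1 (by
    intro p
    rw [one_mul]
    refine lp.norm_le_of_forall_le (norm_nonneg p) fun w => ?_
    simp only [LinearMap.coe_mk, AddHom.coe_mk, norm_mul, Real.norm_eq_abs]
    exact (mul_le_of_le_one_left (abs_nonneg _) (abs_prefixWeight_le i w)).trans
      (lp.norm_apply_le_norm ENNReal.top_ne_zero p _))

@[simp]
theorem prepend_apply (i : I) (p : WordSpace I) (w : List I) :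
    prepend i p w = prefixWeight i w * p w.tail := rfl

theorem prepend_mul_self (i : I) : prepend i * prepend i = 0 := by
  ext p w
  simp [← mul_assoc, prefixWeight_mul_tail]

/-- The nonzero functions of bounded degree whose words of highest degree start with `i`. -/
def leadingLetter (i : I) : Set (WordSpace I) :=
  {p | ∃ n, (∃ w : List I, w.length = n ∧ p w ≠ 0) ∧ (∀ w : List I, n < w.length → p w = 0) ∧
    ∀ w : List I, w.length = n → p w ≠ 0 → w.head? = some i}

theorem disjoint_leadingLetter {i j : I} (hij : i ≠ j) :
    Disjoint (leadingLetter i) (leadingLetter j) := by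
  rw [Set.disjoint_left]
  rintro p ⟨m, ⟨v, hv, hpv⟩, hm, hi⟩ ⟨n, ⟨w, hw, hpw⟩, hn, hj⟩
  have hmn : m = n := by
    apply le_antisymm
    · by_contra! h; exact hpv (hn v (hv ▸ h))
    · by_contra! h; exact hpw (hm w (hw ▸ h))
  subst hmn
  have := (hi v hv hpv).symm.trans (hj v hv hpv)
  exact hij (Option.some.inj this)

theorem leadingLetter_nonempty (i : I) : (leadingLetter i).Nonempty := by
  classical
  refine ⟨lp.single ∞ [i] 1, 1, ⟨[i], rfl, by simp⟩, fun w hw => ?_, fun w hw h => ?_⟩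
  · rw [lp.single_apply_ne]
    rintro rfl
    simp at hw
  · by_contra h'
    refine h (lp.single_apply_ne _ _ _ ?_)
    rintro rfl
    simp at h'

/-- The longest words v of p start with j ≠ i, so each i :: v has weight 1 and gets the value n * p
v, while p itself vanishes in that degree. -/
theorem one_add_zsmul_prepend_mem_leadingLetter {i j : I} (hij : i ≠ j) {n : ℤ} (hn : n ≠ 0)
    {p : WordSpace I} (hp : p ∈ leadingLetter j) :
    (1 + n • prepend i : WordSpace I →L[ℝ] WordSpace I) p ∈ leadingLetter i := by
  obtain ⟨m, ⟨v, hv, hpv⟩, hm, hj⟩ := hp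
  have key : ∀ w, (1 + n • prepend i : WordSpace I →L[ℝ] WordSpace I) p w =
      p w + n * (prefixWeight i w * p w.tail) := fun w => by simp; rfl
  have hvj := hj v hv hpv
  refine ⟨m + 1, ⟨i :: v, by simp [hv], ?_⟩, fun w hw => ?_, fun w hw hpw => ?_⟩
  · rw [key, hm _ (by simp [hv])]
    have : prefixWeight i (i :: v) = 1 := by
      simp [prefixWeight, hvj, hij.symm]
    simp [this, hn, hpv]
  · rw [key, hm w (by omega), hm w.tail (by simp; omega)]
    simp
  · rw [key, hm w (by omega)] at hpw
    by_contra h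
    simp [prefixWeight, h] at hpw

theorem lift_oneAdd_prepend_injective [Nontrivial I] :
    Function.Injective (FreeGroup.lift fun i : I =>
      Units.oneAddOfSqZero (prepend i) (prepend_mul_self i)) := by
  set a := fun i : I => Units.oneAddOfSqZero (prepend i) (prepend_mul_self i)
  have : FreeGroup.lift a =
      (Monoid.CoprodI.lift fun i => FreeGroup.lift fun _ => a i).comp
        (@freeGroupEquivCoprodI I).toMonoidHom := by
    ext i
    simp
  rw [this, MonoidHom.coe_comp]
  refine Function.Injective.comp ?_ (MulEquiv.injective freeGroupEquivCoprodI)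
  refine Monoid.CoprodI.lift_injective_of_ping_pong _ ?_ leadingLetter leadingLetter_nonempty
    (fun i j hij => disjoint_leadingLetter hij) ?_
  -- Ping-pong with possibly only two factors needs one with at least three elements; here the
  -- factors are infinite cyclic.
  · inhabit I
    refine Or.inr ⟨default, ?_⟩
    rw [FreeGroup.freeGroupUnitEquivInt.cardinal_eq, Cardinal.mk_denumerable]
    exact Cardinal.natCast_le_aleph0
  · intro i j hij
    refine FreeGroup.freeGroupUnitEquivInt.forall_congr_left.mpr fun n hn => ?_
    have hn0 : n ≠ 0 := by
      rintro rfl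
      exact hn (by simp [FreeGroup.freeGroupUnitEquivInt])
    change (fun p : WordSpace I => FreeGroup.lift (fun _ => a i) (FreeGroup.of () ^ n) • p) '' _ ⊆ _
    rintro _ ⟨p, hp, rfl⟩
    have h := one_add_zsmul_prepend_mem_leadingLetter hij hn0 hp
    rw [← Units.val_oneAddOfSqZero_zpow _ (prepend_mul_self i)] at h
    simp only [map_zpow, FreeGroup.lift_apply_of]
    exact h

end FreeGroup

/-- A free group embeds into the units of a normed algebra with generators of the form `1 + x`
for elements `x` of square zero. -/
theorem FreeGroup.exists_oneAddOfSqZero_lift_injective (I : Type u) :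
    ∃ (E : Type u) (_ : NormedAddCommGroup E) (_ : NormedSpace ℝ E) (x : I → (E →L[ℝ] E))
      (hx : ∀ i, x i * x i = 0),
      Function.Injective (FreeGroup.lift fun i => Units.oneAddOfSqZero (x i) (hx i)) := by
  cases isEmpty_or_nonempty I
  · exact ⟨FreeGroup.WordSpace I, inferInstance, inferInstance, isEmptyElim, isEmptyElim,
      Function.injective_of_subsingleton _⟩
  -- The extra letter guarantees the two letters that ping-pong needs.
  · refine ⟨FreeGroup.WordSpace (Option I), inferInstance, inferInstance,
      fun i => FreeGroup.prepend (some i), fun i => FreeGroup.prepend_mul_self _, ?_⟩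
    have h := FreeGroup.lift_oneAdd_prepend_injective (I := Option I)
    have hm : Function.Injective (FreeGroup.map (some : I → Option I)) :=
      FreeGroup.map_injective (Option.some_injective I)
    convert h.comp hm using 1
    rw [← MonoidHom.coe_comp]
    congr 1
    ext i
    simp

/-! ### Semidirect products and rings of uniformly continuous functions -/

/-- The topology of the product on a semidirect product. -/
abbrev SemidirectProduct.prodTopology {N G : Type*} [Group N] [Group G] [TopologicalSpace N]
    [TopologicalSpace G] (φ : G →* MulAut N) : TopologicalSpace (N ⋊[φ] G) :=
  TopologicalSpace.induced SemidirectProduct.equivProd inferInstance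

theorem SemidirectProduct.isTopologicalGroup_prodTopology {N G : Type*} [Group N] [Group G]
    [TopologicalSpace N] [TopologicalSpace G] [IsTopologicalGroup N] [IsTopologicalGroup G]
    (φ : G →* MulAut N) (hφ : Continuous fun q : G × N => φ q.1 q.2) :
    @IsTopologicalGroup (N ⋊[φ] G) (prodTopology φ) _ := by
  let _ := prodTopology φ
  have he : Continuous (equivProd : N ⋊[φ] G ≃ N × G) := continuous_induced_dom
  have hl : Continuous (fun p : N ⋊[φ] G => p.left) := continuous_fst.comp he
  have hr : Continuous (fun p : N ⋊[φ] G => p.right) := continuous_snd.comp he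
  refine { continuous_mul := continuous_induced_rng.2 ?_, continuous_inv :=
    continuous_induced_rng.2 ?_ }
  · exact ((hl.comp continuous_fst).mul
      (hφ.comp ((hr.comp continuous_fst).prodMk (hl.comp continuous_snd)))).prodMk
      ((hr.comp continuous_fst).mul (hr.comp continuous_snd))
  · exact (hφ.comp (hr.inv.prodMk hl.inv)).prodMk hr.inv

namespace BoundedContinuousFunction

variable {G : Type*} [Group G] [TopologicalSpace G] [IsTopologicalGroup G]
variable {A : Type*} [NormedRing A]

/-- Right translation of bounded continuous functions on a group. -/
def rightShift (g : G) : (G →ᵇ A) →+* (G →ᵇ A) where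
  toFun f := f.compContinuous ⟨fun x => x * g, by fun_prop⟩
  map_one' := rfl
  map_mul' _ _ := rfl
  map_zero' := rfl
  map_add' _ _ := rfl

@[simp]
theorem rightShift_apply (g : G) (f : G →ᵇ A) (x : G) : rightShift g f x = f (x * g) := rfl

theorem rightShift_one (f : G →ᵇ A) : rightShift 1 f = f := by ext; simp

theorem rightShift_rightShift (g h : G) (f : G →ᵇ A) :
    rightShift g (rightShift h f) = rightShift (g * h) f := by ext; simp [mul_assoc]

theorem dist_rightShift_rightShift (g : G) (f f' : G →ᵇ A) :
    dist (rightShift g f) (rightShift g f') ≤ dist f f' :=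
  (dist_le dist_nonneg).2 fun x => dist_coe_le_dist (f := f) (g := f') (x * g)

variable (G A) in
/-- The ring of bounded functions that are uniformly continuous for right translations. -/
def uniformSubring : Subring (G →ᵇ A) where
  carrier := {f | Continuous fun g : G => rightShift g f}
  mul_mem' {a b} ha hb := by
    simp only [Set.mem_ofPred_eq, map_mul] at *
    exact ha.mul hb
  one_mem' := by simpa using continuous_const
  add_mem' {a b} ha hb := by
    simp only [Set.mem_ofPred_eq, map_add] at *
    exact ha.add hb
  zero_mem' := by simpa using continuous_const
  neg_mem' {a} ha := by
    simp only [Set.mem_ofPred_eq, map_neg] at *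
    exact ha.neg

theorem mem_uniformSubring {f : G →ᵇ A} :
    f ∈ uniformSubring G A ↔ Continuous fun g : G => rightShift g f := Iff.rfl

/-- Right translation on the ring of uniformly continuous functions. -/
noncomputable def uniformShift (g : G) : uniformSubring G A →+* uniformSubring G A :=
  (rightShift g).restrict _ _ fun f hf => by
    simp only [mem_uniformSubring, rightShift_rightShift] at *
    exact hf.comp (continuous_mul_const g)

theorem coe_uniformShift (g : G) (f : uniformSubring G A) :
    (uniformShift g f : G →ᵇ A) = rightShift g f := rfl

/-- Translations do not increase distances, so joint continuity reduces to continuity of the single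
orbits, which defines the ring. -/
theorem continuous_uniformShift :
    Continuous fun q : G × uniformSubring G A => uniformShift q.1 q.2 := by
  rw [Topology.IsInducing.subtypeVal.continuous_iff, continuous_iff_continuousAt]
  rintro ⟨g, f⟩
  rw [ContinuousAt, tendsto_iff_dist_tendsto_zero]
  have h1 : Tendsto (fun q : G × uniformSubring G A =>
      dist (q.2 : G →ᵇ A) f + dist (rightShift q.1 (f : G →ᵇ A)) (rightShift g f))
      (𝓝 (g, f)) (𝓝 0) := by
    have hf : Continuous fun g : G => rightShift g (f : G →ᵇ A) := f.2
    have : Continuous (fun q : G × uniformSubring G A =>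
      dist (q.2 : G →ᵇ A) f + dist (rightShift q.1 (f : G →ᵇ A)) (rightShift g f)) :=
      ((continuous_subtype_val.comp continuous_snd).dist continuous_const).add
        ((hf.comp continuous_fst).dist continuous_const)
    simpa using this.tendsto (g, f)
  refine squeeze_zero (fun _ => dist_nonneg) (fun q => ?_) h1
  exact (dist_triangle _ (rightShift q.1 (f : G →ᵇ A)) _).trans
    (add_le_add_left (dist_rightShift_rightShift _ _ _) _)

variable (G A) in
/-- The action of a topological group by right translation on the units of the ring of uniformly
continuous functions. -/
noncomputable def unitsShift : G →* MulAut (uniformSubring G A)ˣ where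
  toFun g :=
    { toFun := Units.map (uniformShift (A := A) g).toMonoidHom
      invFun := Units.map (uniformShift (A := A) g⁻¹).toMonoidHom
      left_inv := fun u => by
        ext1; apply Subtype.ext
        simp [coe_uniformShift, rightShift_rightShift, rightShift_one]
      right_inv := fun u => by
        ext1; apply Subtype.ext
        simp [coe_uniformShift, rightShift_rightShift, rightShift_one]
      map_mul' := map_mul _ }
  map_one' := by
    ext1 u; ext1; apply Subtype.ext
    simp [coe_uniformShift, rightShift_one]
  map_mul' g h := by
    ext1 u; ext1; apply Subtype.ext
    simp [coe_uniformShift, rightShift_rightShift]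

theorem continuous_unitsShift :
    Continuous fun q : G × (uniformSubring G A)ˣ => unitsShift G A q.1 q.2 := by
  rw [Units.continuous_iff]
  constructor
  · exact continuous_uniformShift.comp
      (continuous_fst.prodMk (Units.continuous_val.comp continuous_snd))
  · simp only [← map_inv]
    exact continuous_uniformShift.comp
      (continuous_fst.prodMk (Units.continuous_val.comp continuous_snd.inv))

variable (A) in
/-- Evaluation of uniformly continuous functions at a point. -/
def evalUniform (x : G) : uniformSubring G A →+* A where
  toFun f := (f : G →ᵇ A) x
  map_one' := rfl
  map_mul' _ _ := rfl
  map_zero' := rfl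
  map_add' _ _ := rfl

theorem evalUniform_apply (x : G) (f : uniformSubring G A) :
    evalUniform A x f = (f : G →ᵇ A) x := rfl

theorem continuous_evalUniform (x : G) : Continuous (evalUniform (G := G) A x) :=
  (BoundedContinuousFunction.lipschitz_eval_const x).continuous.comp continuous_subtype_val

/-- Finitely many prescribed elements of square zero are the values of an element of square zero
of the ring of uniformly continuous functions. -/
theorem exists_uniform_sq_zero [NormedAlgebra ℝ A] [T1Space G] (S : Finset G) {X : Type*}
    (a : G → X → A) (ha : ∀ s x, a s x * a s x = 0) :
    ∃ h : X → uniformSubring G A, (∀ x, h x * h x = 0) ∧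
      ∀ x, ∀ s ∈ S, (h x : G →ᵇ A) s = a s x := by
  classical
  -- This neighbourhood omits s⁻¹ * t for distinct s, t in `S`; once V V⁻¹ lies in it, the
  -- translates s V are disjoint.
  have hU : (⋂ q ∈ S ×ˢ S, {g : G | g = q.1⁻¹ * q.2 → q.1 = q.2}) ∈ 𝓝 (1 : G) := by
    rw [Filter.biInter_finset_mem]
    rintro ⟨s, t⟩ -
    by_cases h : s = t
    · simp [h]
    · have : (1 : G) ≠ s⁻¹ * t := by
        rw [ne_comm, ne_eq, inv_mul_eq_one]; exact h
      filter_upwards [isOpen_ne.mem_nhds this] with g hg hg'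
      exact absurd hg' hg
  obtain ⟨V, hV, hVU⟩ := exists_nhds_split_inv hU
  obtain ⟨ψ, hψ1, hψ0, hψ2, hψV, hψu⟩ := exists_bump_right_uniform hV
  have hψc : Continuous ψ := by
    rw [continuous_iff_continuousAt]
    intro x
    rw [ContinuousAt, Metric.tendsto_nhds]
    intro ε hε
    have ht : Tendsto (fun y => x⁻¹ * y) (𝓝 x) (𝓝 1) := by
      simpa using (continuous_const_mul x⁻¹).tendsto x
    filter_upwards [ht (hψu ε hε)] with y hy
    simpa [Real.dist_eq] using hy x
  let Ψ : G →ᵇ ℝ := BoundedContinuousFunction.ofNormedAddCommGroup ψ hψc 1 fun x => by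
    rw [Real.norm_eq_abs, abs_of_nonneg (hψ0 x)]; exact hψ2 x
  have hΨ : Continuous fun g : G => rightShift g Ψ := by
    rw [continuous_iff_continuousAt]
    intro g
    rw [ContinuousAt, Metric.tendsto_nhds]
    intro ε hε
    have ht : Tendsto (fun y => g⁻¹ * y) (𝓝 g) (𝓝 1) := by
      simpa using (continuous_const_mul g⁻¹).tendsto g
    filter_upwards [ht (hψu (ε / 2) (half_pos hε))] with y hy
    refine lt_of_le_of_lt ((dist_le (half_pos hε).le).2 fun x => ?_) (half_lt_self hε)
    have := (hy (x * g)).le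
    change |ψ (x * y) - ψ (x * g)| ≤ ε / 2
    simpa [mul_assoc] using this
  have hdisj : ∀ s ∈ S, ∀ t ∈ S, s ≠ t → ∀ y, ψ (s⁻¹ * y) * ψ (t⁻¹ * y) = 0 := by
    intro s hs t ht hst y
    by_contra h
    obtain ⟨h1, h2⟩ := mul_ne_zero_iff.1 h
    have hs' : s⁻¹ * y ∈ V := by by_contra h'; exact h1 (hψV _ h')
    have ht' : t⁻¹ * y ∈ V := by by_contra h'; exact h2 (hψV _ h')
    have := Set.mem_iInter₂.1 (hVU _ hs' _ ht') (s, t) (Finset.mk_mem_product hs ht)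
    exact hst (this (by simp [div_eq_mul_inv]))
  let L : G → A → G →ᵇ A := fun s b =>
    (ContinuousLinearMap.toSpanSingleton ℝ b).compLeftContinuousBounded G
      (Ψ.compContinuous ⟨fun x => s⁻¹ * x, by fun_prop⟩)
  have hLapp : ∀ s b y, L s b y = ψ (s⁻¹ * y) • b := fun s b y => rfl
  have hL : ∀ s b, L s b ∈ uniformSubring G A := by
    intro s b
    rw [mem_uniformSubring]
    have : ∀ g, rightShift g (L s b) =
        (ContinuousLinearMap.toSpanSingleton ℝ b).compLeftContinuousBounded G
          ((rightShift g Ψ).compContinuous ⟨fun x => s⁻¹ * x, by fun_prop⟩) := by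
      intro g; ext y
      change ψ (s⁻¹ * (y * g)) • b = ψ (s⁻¹ * y * g) • b
      rw [mul_assoc]
    simp only [this]
    exact (ContinuousLinearMap.continuous _).comp ((continuous_compContinuous _).comp hΨ)
  refine ⟨fun x => ∑ s ∈ S, ⟨L s (a s x), hL _ _⟩, fun x => ?_, fun x s hs => ?_⟩
  · rw [Finset.sum_mul_sum]
    -- Cross terms vanish by disjointness of supports, diagonal terms because `a s x` has square
    -- zero.
    refine Finset.sum_eq_zero fun s hs => Finset.sum_eq_zero fun t ht => ?_
    apply Subtype.ext
    ext y
    change ψ (s⁻¹ * y) • a s x * ψ (t⁻¹ * y) • a t x = 0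
    rw [smul_mul_smul_comm]
    by_cases hst : s = t
    · subst hst; rw [ha, smul_zero]
    · rw [hdisj s hs t ht hst, zero_smul]
  · rw [← evalUniform_apply, map_sum, Finset.sum_eq_single s]
    · change ψ (s⁻¹ * s) • a s x = _
      simp [hψ1]
    · intro t ht hts
      change ψ (t⁻¹ * s) • a t x = 0
      have := hdisj t ht s hs hts s
      rw [inv_mul_cancel, hψ1, mul_one] at this
      rw [this, zero_smul]
    · exact fun h => absurd hs h

end BoundedContinuousFunction

/-! ### Separating elements of the free kernel -/

/-- The action of a group `G` on the free group over `G × X` by left translation of the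
generators. -/
def FreeGroup.translate (G X : Type*) [Group G] : G →* MulAut (FreeGroup (G × X)) where
  toFun g := FreeGroup.freeGroupCongr ((Equiv.mulLeft g).prodCongr (Equiv.refl X))
  map_one' := by
    refine MulEquiv.toMonoidHom_injective (FreeGroup.ext_hom _ _ fun i => ?_)
    simp
  map_mul' g h := by
    refine MulEquiv.toMonoidHom_injective (FreeGroup.ext_hom _ _ fun i => ?_)
    rcases i with ⟨s, x⟩
    simp [mul_assoc]

@[simp]
theorem FreeGroup.translate_of {G X : Type*} [Group G] (g s : G) (x : X) :
    FreeGroup.translate G X g (FreeGroup.of (s, x)) = FreeGroup.of (g * s, x) := rfl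

/-- An element of a free group involves only finitely many generators. -/
theorem FreeGroup.exists_finset_lift_eq {I : Type*} (v : FreeGroup I) :
    ∃ S : Finset I, ∀ (K : Type*) [Group K] (f g : I → K), (∀ i ∈ S, f i = g i) →
      FreeGroup.lift f v = FreeGroup.lift g v := by
  classical
  induction v using FreeGroup.induction_on with
  | C1 => exact ⟨∅, by simp⟩
  | of i => exact ⟨{i}, by simp⟩
  | inv_of i h =>
    obtain ⟨S, hS⟩ := h
    exact ⟨S, fun K _ f g hfg => by rw [_root_.map_inv, _root_.map_inv, hS K f g hfg]⟩
  | mul a b ha hb =>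
    obtain ⟨S, hS⟩ := ha
    obtain ⟨R, hR⟩ := hb
    refine ⟨S ∪ R, fun K _ f g hfg => ?_⟩
    rw [_root_.map_mul, _root_.map_mul, hS K f g fun i hi => hfg i (Finset.mem_union_left _ hi),
      hR K f g fun i hi => hfg i (Finset.mem_union_right _ hi)]

/-- Group topologies on the semidirect product of the free group over `G × X` and `G` which are
compatible with the topology of `G` separate the elements of the free group from `1`. -/
theorem exists_groupTopology_semidirect_separating {G X : Type*} [Group G] [TopologicalSpace G]
    [IsTopologicalGroup G] [T1Space G]
    (p : FreeGroup (G × X) ⋊[FreeGroup.translate G X] G) (hp : p.left ≠ 1) :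
    ∃ t : TopologicalSpace (FreeGroup (G × X) ⋊[FreeGroup.translate G X] G),
      @IsTopologicalGroup _ t _ ∧
      Continuous[_, t] (SemidirectProduct.inr (φ := FreeGroup.translate G X)) ∧
      ∃ U ∈ @nhds _ t 1, p ∉ U := by
  classical
  obtain ⟨E, _, _, a, ha, hinj⟩ := FreeGroup.exists_oneAddOfSqZero_lift_injective (G × X)
  obtain ⟨S, hS⟩ := FreeGroup.exists_finset_lift_eq p.left
  obtain ⟨h, hh, hval⟩ := exists_uniform_sq_zero (S.image Prod.fst) (fun s x => a (s, x))
    fun s x => ha (s, x)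
  let R := uniformSubring G (E →L[ℝ] E)
  -- Equivariance forces the value at (s, x) to be the s-translate of the value at (1, x).
  let θ : FreeGroup (G × X) →* Rˣ := FreeGroup.lift fun i =>
    unitsShift G (E →L[ℝ] E) i.1 (Units.oneAddOfSqZero (h i.2) (hh i.2))
  have hθ : ∀ g : G, θ.comp (FreeGroup.translate G X g).toMonoidHom =
      (unitsShift G (E →L[ℝ] E) g).toMonoidHom.comp θ := by
    intro g
    ext1 ⟨s, x⟩
    simp [θ]
  let κ : FreeGroup (G × X) ⋊[FreeGroup.translate G X] G →* Rˣ ⋊[unitsShift G (E →L[ℝ] E)] G :=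
    SemidirectProduct.map θ (MonoidHom.id G) hθ
  let t₀ := SemidirectProduct.prodTopology (unitsShift G (E →L[ℝ] E))
  have ht₀ : IsTopologicalGroup (Rˣ ⋊[unitsShift G (E →L[ℝ] E)] G) :=
    SemidirectProduct.isTopologicalGroup_prodTopology _ continuous_unitsShift
  let t := t₀.induced κ
  have hκ : Continuous κ := continuous_induced_dom
  refine ⟨t, topologicalGroup_induced κ, ?_, ?_⟩
  · refine continuous_induced_rng.2 (continuous_induced_rng.2 ?_)
    exact continuous_const.prodMk continuous_id
  · let ev : FreeGroup (G × X) ⋊[FreeGroup.translate G X] G → E →L[ℝ] E :=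
      fun q => evalUniform (E →L[ℝ] E) 1 ((θ q.left : Rˣ) : R)
    have hev : Continuous ev := by
      have h1 : Continuous fun q : Rˣ ⋊[unitsShift G (E →L[ℝ] E)] G => q.left :=
        continuous_fst.comp (continuous_induced_dom (f := SemidirectProduct.equivProd))
      exact (continuous_evalUniform 1).comp (Units.continuous_val.comp (h1.comp hκ))
    have hval' : ∀ v, Units.map (evalUniform (E →L[ℝ] E) 1).toMonoidHom (θ v) =
        FreeGroup.lift (fun i : G × X => Units.map (evalUniform (E →L[ℝ] E) 1).toMonoidHom
          (unitsShift G (E →L[ℝ] E) i.1 (Units.oneAddOfSqZero (h i.2) (hh i.2)))) v := by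
      intro v
      rw [← MonoidHom.comp_apply]
      congr 1
      ext i
      simp [θ]
    have hne : ev p ≠ 1 := by
      intro h1
      apply hp
      apply hinj
      have h1' : Units.map (evalUniform (E →L[ℝ] E) 1).toMonoidHom (θ p.left) = 1 := Units.ext h1
      rw [map_one, ← h1', hval']
      refine hS _ _ _ fun i hi => Units.ext ?_
      have := hval i.2 i.1 (Finset.mem_image_of_mem _ hi)
      change 1 + a i = (1 : E →L[ℝ] E) + (h i.2 : G →ᵇ (E →L[ℝ] E)) (1 * i.1)
      rw [one_mul, this]
    refine ⟨ev ⁻¹' {ev p}ᶜ, ?_, by simp⟩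
    refine (isOpen_compl_singleton.preimage hev).mem_nhds ?_
    have : ev 1 = 1 := by simp [ev]
    simpa [this] using hne.symm

/-! ### Extension of topologies -/

/-- A Hausdorff group topology on a retract extends, provided that group topologies compatible
with it separate the kernel of the retraction from `1`. -/
theorem IsHausdorffGroupTopology.exists_extension {G P : Type*} [Group G] [Group P]
    {T : TopologicalSpace G} (hT : IsHausdorffGroupTopology T) (ι : G →* P) (ρ : P →* G)
    (hρ : ∀ g, ρ (ι g) = g)
    (hsep : ∀ p ≠ 1, ρ p = 1 → ∃ t : TopologicalSpace P, @IsTopologicalGroup P t _ ∧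
      Continuous[T, t] ι ∧ ∃ U ∈ @nhds P t 1, p ∉ U) :
    ∃ T' : TopologicalSpace P, IsHausdorffGroupTopology T' ∧ T = T'.induced ι := by
  have := hT.isTopologicalGroup
  have := hT.t2Space
  let 𝒯 : Set (TopologicalSpace P) := {t | @IsTopologicalGroup P t _ ∧ Continuous[T, t] ι}
  have hmem : T.induced ρ ∈ 𝒯 := by
    refine ⟨topologicalGroup_induced ρ, continuous_induced_rng.2 ?_⟩
    exact continuous_id.congr fun g => (hρ g).symm
  -- In the order on topologies smaller means finer, so this is the join of `𝒯`.
  let T' : TopologicalSpace P := sInf 𝒯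
  have hgrp : IsTopologicalGroup P := topologicalGroup_sInf fun t ht => ht.1
  have hcont : Continuous[T, T'] ι := continuous_sInf_rng.2 fun t ht => ht.2
  refine ⟨T', ⟨hgrp, ?_⟩, le_antisymm (continuous_iff_le_induced.1 hcont) ?_⟩
  · refine IsTopologicalGroup.t2Space_of_one_sep fun p hp => ?_
    have key : ∀ t ∈ 𝒯, ∀ U ∈ @nhds P t 1, U ∈ 𝓝 (1 : P) := fun t ht U hU =>
      nhds_mono (sInf_le ht) hU
    by_cases h : ρ p = 1
    · obtain ⟨t, ht, hι, U, hU, hpU⟩ := hsep p hp h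
      exact ⟨U, key t ⟨ht, hι⟩ U hU, hpU⟩
    · refine ⟨ρ ⁻¹' {ρ p}ᶜ, key _ hmem _ ?_, by simp⟩
      rw [nhds_induced, map_one]
      exact preimage_mem_comap (isOpen_compl_singleton.mem_nhds (Ne.symm h))
  · calc T'.induced ι ≤ (T.induced ρ).induced ι := induced_mono (sInf_le hmem)
      _ = T := by
        rw [induced_compose, show ρ ∘ ι = id from funext hρ, induced_id]

/-- Every Hausdorff group topology on the free group over a subset extends to the whole free
group. -/
theorem FreeGroup.exists_extension_hausdorffGroupTopology {X : Type*} (Z : Set X)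
    (T : TopologicalSpace (FreeGroup Z)) (hT : IsHausdorffGroupTopology T) :
    ∃ T' : TopologicalSpace (FreeGroup X), IsHausdorffGroupTopology T' ∧
      T = TopologicalSpace.induced (FreeGroup.map (Subtype.val : Z → X)) T' := by
  classical
  have := hT.isTopologicalGroup
  have := hT.t2Space
  let G := FreeGroup Z
  let ι : G →* FreeGroup X := FreeGroup.map Subtype.val
  let Φ : FreeGroup X →* FreeGroup (G × X) ⋊[FreeGroup.translate G X] G :=
    FreeGroup.lift fun x => if h : x ∈ Z then SemidirectProduct.inr (FreeGroup.of ⟨x, h⟩)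
      else SemidirectProduct.inl (FreeGroup.of (1, x))
  -- A left inverse of `Φ`, which is therefore injective.
  let Ψ : FreeGroup (G × X) ⋊[FreeGroup.translate G X] G →* FreeGroup X :=
    SemidirectProduct.lift (FreeGroup.lift fun i => ι i.1 * FreeGroup.of i.2 * (ι i.1)⁻¹) ι
      fun g => by ext1 ⟨s, x⟩; simp [mul_assoc]
  have hΨ : ∀ p, Ψ (Φ p) = p := by
    intro p
    suffices Ψ.comp Φ = MonoidHom.id _ from DFunLike.congr_fun this p
    ext1 x
    by_cases h : x ∈ Z
    · simp only [Φ, Ψ, h, MonoidHom.comp_apply, FreeGroup.lift_apply_of, dif_pos,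
        SemidirectProduct.lift_inr, MonoidHom.id_apply]
      exact FreeGroup.map.of
    · simp [Φ, Ψ, h, ι]
  have hΦι : ∀ g, Φ (ι g) = SemidirectProduct.inr g := by
    intro g
    suffices Φ.comp ι = SemidirectProduct.inr from DFunLike.congr_fun this g
    ext1 z
    simp [Φ, ι]
  refine hT.exists_extension ι (SemidirectProduct.rightHom.comp Φ) (fun g => by simp [hΦι]) ?_
  intro p hp hρ
  have hleft : (Φ p).left ≠ 1 := by
    intro h
    apply hp
    rw [← hΨ p, show Φ p = 1 from SemidirectProduct.ext h hρ, _root_.map_one]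
  obtain ⟨t, ht, hι, U, hU, hpU⟩ := exists_groupTopology_semidirect_separating (Φ p) hleft
  refine ⟨t.induced Φ, topologicalGroup_induced Φ, continuous_induced_rng.2 ?_, Φ ⁻¹' U, ?_, hpU⟩
  · exact hι.congr fun g => (hΦι g).symm
  · rw [nhds_induced, _root_.map_one]
    exact preimage_mem_comap hU

theorem FreeGroup.range_map_subtype_val {X : Type*} (Z : Set X) :
    (FreeGroup.map (Subtype.val : Z → X)).range = Subgroup.closure (FreeGroup.of '' Z) := by
  rw [MonoidHom.range_eq_map, ← FreeGroup.closure_range_of, MonoidHom.map_closure, ← Set.range_comp]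
  congr 1
  ext
  simp

/-- The first part is about the free group on `Z` and the canonical map into the free group on
`X`; the second is about the subgroup of the free group on `X` that is generated by `Z`, with
which the free group on `Z` is identified. -/
theorem corollary4p3 {X : Type*} (Z : Set X) (hZ : Z.Countable) :
    (∀ T : TopologicalSpace (FreeGroup Z), IsHausdorffGroupTopology T →
      ∃ T' : TopologicalSpace (FreeGroup X), IsHausdorffGroupTopology T' ∧
        T = TopologicalSpace.induced (FreeGroup.map (Subtype.val : Z → X)) T') ∧
    (Subgroup.closure (FreeGroup.of '' Z)).IsHausdorffEmbedded := by
  refine ⟨FreeGroup.exists_extension_hausdorffGroupTopology Z, fun T hT => ?_⟩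
  let e : FreeGroup Z ≃* Subgroup.closure (FreeGroup.of '' Z) :=
    (MonoidHom.ofInjective (FreeGroup.map_injective Subtype.val_injective)).trans
      (MulEquiv.subgroupCongr (FreeGroup.range_map_subtype_val Z))
  have := hT.isTopologicalGroup
  have := hT.t2Space
  let T₀ := T.induced e
  have he : IsEmbedding e := ⟨⟨rfl⟩, e.injective⟩
  obtain ⟨T', hT', h⟩ := FreeGroup.exists_extension_hausdorffGroupTopology Z T₀
    ⟨topologicalGroup_induced e, he.t2Space⟩
  refine ⟨T', hT', ?_⟩
  have h' : T.induced e = (T'.induced Subtype.val).induced e := by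
    rw [induced_compose]
    exact h
  have hsymm : e ∘ e.symm = id := funext e.apply_symm_apply
  have hinj (S : TopologicalSpace (Subgroup.closure (FreeGroup.of '' Z))) :
      (S.induced e).induced e.symm = S := by
    rw [induced_compose, hsymm, induced_id]
  rw [← hinj T, h', hinj]
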